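/- Let $R$ be a finite (not necessarily commutative) Frobenius ring, i.e. a finite ring having a character $\chi\colon(R,+)\to\mathbb{C}^\times$ whose kernel contains no nonzero left (equivalently, right) ideal, and let $$\mathrm{w}_{\mathrm{hom}}(x)=1-\frac{1}{|R^\times|}\sum_{u\in R^\times}\chi(ux)\qquad(x\in R)$$ be its normalized homogeneous weight (which does not depend on the choice of $\chi$), extended to $R^n$ by $\mathrm{w}_{\mathrm{hom}}(\mathbf{c})=\sum_{j}\mathrm{w}_{\mathrm{hom}}(c_j)$. Let $C\le {}_RR^n$ be a left linear code generated by a matrix $\mathbf{G}=(\mathbf{g}_1|\dots|\mathbf{g}_n)\in R^{k\times n}$, i.e. $C=\{\mathbf{x}\mathbf{G}:\mathbf{x}\in R^k\}$, and let $D=\{\mathbf{G}\mathbf{y}:\mathbf{y}\in R^n\}\le R^k_R$ be the right column space of $\mathbf{G}$. Suppose that * $C$ is modular: there is $r\in\mathbb{Q}$ such that for every nonzero $\mathbf{g}\in R^k$ the number $|\{j:\mathbf{g}_jR=\mathbf{g}R\}|$ equals either $0$ or $r\,|\mathbf{g}R^\times|$ (this property depends only on $C$, not on $\mathbf{G}$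 or $k$); * $C$ has no all-zero coordinate; * $C_0=\{\mathbf{c}\in C:\mathrm{w}_{\mathrm{hom}}(\mathbf{c})=0\}=\{\mathbf{0}\}$. Then the following are equivalent: 1. $C$ is a homogeneous two-weight code, i.e. the codewords of $C$ have exactly two nonzero homogeneous weights $w_1<w_2$; 2. $\Omega=\mathbf{g}_1R^\times\cup\dots\cup\mathbf{g}_nR^\times$ is a partial difference set in $(D,+)$, and $\Omega\cup\{\mathbf{0}\}$ is not a submodule of $R^k_R$. Here a subset $S$ of a finite abelian group $H$ is a (regular) partial difference set if $0\notin S$, $-S=S$, and there are integers $\lambda,\mu\ge 0$ such that every element of $S$ has exactly $\lambda$ representations, and every element of $H\setminus(S\cup\{0\})$ exactly $\mu$ representations, as $s-t$ with $s,t\in S$. -/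

import Mathlib

/-! Homogeneous weights on finite Frobenius rings.  Left modules over `R` are `R`-modules and
right modules over `R` are `Rᵐᵒᵖ`-modules. -/

namespace FrobCode

/-- A character `χ` of `(R, +)` is generating if its kernel contains no nonzero left ideal of `R`.
A finite ring is a Frobenius ring iff it has such a character. -/
def IsGenerating {R : Type*} [Ring R] (χ : AddChar R ℂ) : Prop :=
  ∀ I : Ideal R, (∀ x ∈ I, χ x = 1) → I = ⊥

/-- For a finite ring, left and right ideals give the same notion of generating character. -/
theorem isGenerating_iff_right {R : Type*} [Ring R] [Finite R] (χ : AddChar R ℂ) :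
    IsGenerating χ ↔ ∀ J : Submodule Rᵐᵒᵖ R, (∀ x ∈ J, χ x = 1) → J = ⊥ := by
  cases nonempty_fintype R
  constructor
  · intro h J hJ
    let φ : R → AddChar R ℂ := fun r => χ.compAddMonoidHom (AddMonoidHom.mulRight r)
    have hinj : Function.Injective φ := by
      intro a b hab
      have hI := h (Ideal.span {a - b}) (by
        intro x hx
        obtain ⟨y, rfl⟩ := Ideal.mem_span_singleton'.1 hx
        have h1 : χ (y * a) = χ (y * b) := DFunLike.congr_fun hab y
        rw [mul_sub, AddChar.map_sub_eq_div, h1]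
        exact div_self (AddChar.val_isUnit χ _).ne_zero)
      exact sub_eq_zero.1 (Ideal.span_singleton_eq_bot.1 hI)
    have hsurj : Function.Surjective φ :=
      (Function.Injective.bijective_of_nat_card_le hinj
        (by simp [Nat.card_eq_fintype_card])).2
    refine (Submodule.eq_bot_iff _).2 fun x hx => ?_
    by_contra hx0
    obtain ⟨ψ, hψ⟩ := AddChar.exists_apply_ne_zero.2 hx0
    obtain ⟨r, rfl⟩ := hsurj ψ
    exact hψ (hJ _ (J.smul_mem (MulOpposite.op r) hx))
  · intro h J hJ
    let φ : R → AddChar R ℂ := fun r => χ.compAddMonoidHom (AddMonoidHom.mulLeft r)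
    have hinj : Function.Injective φ := by
      intro a b hab
      have hI := h (Submodule.span Rᵐᵒᵖ {a - b}) (by
        intro x hx
        obtain ⟨y, rfl⟩ := Submodule.mem_span_singleton.1 hx
        have h1 : χ (a * y.unop) = χ (b * y.unop) := DFunLike.congr_fun hab y.unop
        rw [MulOpposite.smul_eq_mul_unop, sub_mul, AddChar.map_sub_eq_div, h1]
        exact div_self (AddChar.val_isUnit χ _).ne_zero)
      exact sub_eq_zero.1 (Submodule.span_singleton_eq_bot.1 hI)
    have hsurj : Function.Surjective φ :=
      (Function.Injective.bijective_of_nat_card_le hinj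
        (by simp [Nat.card_eq_fintype_card])).2
    refine (Submodule.eq_bot_iff _).2 fun x hx => ?_
    by_contra hx0
    obtain ⟨ψ, hψ⟩ := AddChar.exists_apply_ne_zero.2 hx0
    obtain ⟨r, rfl⟩ := hsurj ψ
    exact hψ (hJ _ (J.smul_mem r hx))

/-- The normalized homogeneous weight `x ↦ 1 - |Rˣ|⁻¹ ∑_{u ∈ Rˣ} χ(ux)`. -/
noncomputable def homWeight {R : Type*} [Ring R] (χ : AddChar R ℂ) (x : R) : ℂ :=
  1 - (Nat.card Rˣ : ℂ)⁻¹ * ∑ᶠ u : Rˣ, χ ((u : R) * x)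

/-- The homogeneous weight of a word is the sum of the weights of its coordinates. -/
noncomputable def wordWeight {R : Type*} [Ring R] (χ : AddChar R ℂ) {n : ℕ} (c : Fin n → R) : ℂ :=
  ∑ j, homWeight χ (c j)

/-- `C` has exactly two nonzero homogeneous weights `w₁ < w₂`. -/
def IsTwoWeight {R : Type*} [Ring R] (χ : AddChar R ℂ) {n : ℕ}
    (C : Submodule R (Fin n → R)) : Prop :=
  ∃ w₁ w₂ : ℝ, w₁ < w₂ ∧ (wordWeight χ '' (C : Set (Fin n → R))) \ {0} = {(w₁ : ℂ), (w₂ : ℂ)}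

/-- The left row space `{xG : x ∈ R^k}` of a matrix. -/
def rowSpace {R : Type*} [Ring R] {k n : ℕ} (G : Matrix (Fin k) (Fin n) R) :
    Submodule R (Fin n → R) :=
  Submodule.span R (Set.range G.row)

/-- The right column space `{Gy : y ∈ R^n}` of a matrix. -/
def colSpace {R : Type*} [Ring R] {k n : ℕ} (G : Matrix (Fin k) (Fin n) R) :
    Submodule Rᵐᵒᵖ (Fin k → R) :=
  Submodule.span Rᵐᵒᵖ (Set.range G.col)

/-- The cyclic right submodule `gR` of `R^k`. -/
def cyclic {R : Type*} [Ring R] {k : ℕ} (g : Fin k → R) : Submodule Rᵐᵒᵖ (Fin k → R) :=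
  Submodule.span Rᵐᵒᵖ {g}

/-- The set `gRˣ` of right unit multiples of `g`. -/
def unitOrbit {R : Type*} [Ring R] {k : ℕ} (g : Fin k → R) : Set (Fin k → R) :=
  Set.range fun u : Rˣ => fun i => g i * (u : R)

/-- The multiplicity of the point `P` in the multiset `{g₁R, …, g_nR}` of cyclic submodules
generated by the columns of `G`. -/
noncomputable def pointMult {R : Type*} [Ring R] {k n : ℕ} (G : Matrix (Fin k) (Fin n) R)
    (P : Submodule Rᵐᵒᵖ (Fin k → R)) : ℕ :=
  {j : Fin n | cyclic (G.col j) = P}.ncard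

/-- The code `C` is modular: for a generator matrix `G` of `C` there is a rational `r` (the index)
such that every point `gR` has multiplicity `0` or `r|gRˣ|`.  (This does not depend on the choice
of `G` or of its number of rows.) -/
def IsModular {R : Type*} [Ring R] {n : ℕ} (C : Submodule R (Fin n → R)) : Prop :=
  ∃ (k : ℕ) (G : Matrix (Fin k) (Fin n) R), rowSpace G = C ∧
    ∃ r : ℚ, ∀ g : Fin k → R, g ≠ 0 →
      pointMult G (cyclic g) = 0 ∨ (pointMult G (cyclic g) : ℚ) = r * (unitOrbit g).ncard

/-- The union `Ω = g₁Rˣ ∪ … ∪ g_nRˣ` over the columns of `G`. -/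
def omega {R : Type*} [Ring R] {k n : ℕ} (G : Matrix (Fin k) (Fin n) R) : Set (Fin k → R) :=
  ⋃ j : Fin n, unitOrbit (G.col j)

/-- `S` is a regular `(N, K, l, m)` partial difference set in the finite abelian group `H`:
`N = |H|`, `K = |S|`, `0 ∉ S`, `-S = S`, and the multiset `S - S` represents each element of `S`
exactly `l` times and every other nonzero element of `H` exactly `m` times. -/
def IsRegularPDS {H : Type*} [AddCommGroup H] [Finite H] (S : Set H) (N K l m : ℕ) : Prop :=
  N = Nat.card H ∧ K = S.ncard ∧ 0 ∉ S ∧ (∀ x ∈ S, -x ∈ S) ∧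
    (∀ x ∈ S, {p : H × H | p.1 ∈ S ∧ p.2 ∈ S ∧ p.1 - p.2 = x}.ncard = l) ∧
    (∀ x ∉ S, x ≠ 0 → {p : H × H | p.1 ∈ S ∧ p.2 ∈ S ∧ p.1 - p.2 = x}.ncard = m)

/-- `S` is a partial difference set in `H` (for some parameters). -/
def IsPDS {H : Type*} [AddCommGroup H] [Finite H] (S : Set H) : Prop :=
  ∃ N K l m : ℕ, IsRegularPDS S N K l m

end FrobCode

namespace FrobCode

/-! The weights of `C` are character sums of `Ω` in disguise. A generating character lets the unit
average in the weight act on the right, hence on the columns of `G`; modularity turns the sum over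
all `g_j u` into a multiple of the sum over `Ω`. So `xG` has weight `n - r * charSum Ω ψ_x`, where
`ψ_x y = χ (x ⬝ᵥ y)` on `D` (`wordWeight_vecMul`). Every character of `D` is some `ψ_x`, trivial
exactly when `xG = 0`, so by `C₀ = 0` the nonzero weights are an affine image of the nontrivial
character sums.

By Fourier analysis on `D`, these sums take exactly two values iff `Ω` is a partial difference set
other than `∅` and `D \ {0}` (`isPDS_and_iff_charSum_image`); the excluded cases are those where `Ω
∪ {0}` is a submodule.

Modularity is given for some generator matrix; moving it to `G` needs that generators of the same
cyclic module differ by a unit (`exists_unit_smul_eq_of_span_eq`). -/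

/-- The number of representations of `x` as a difference of two elements of `S`. -/
noncomputable def diffCount {H : Type*} [AddCommGroup H] (S : Set H) (x : H) : ℕ :=
  {p : H × H | p.1 ∈ S ∧ p.2 ∈ S ∧ p.1 - p.2 = x}.ncard

theorem diffCount_zero {H : Type*} [AddCommGroup H] (S : Set H) : diffCount S 0 = S.ncard := by
  have : {p : H × H | p.1 ∈ S ∧ p.2 ∈ S ∧ p.1 - p.2 = 0} = (fun x => (x, x)) '' S := by
    ext ⟨a, b⟩
    simp only [Set.mem_ofPred_eq, Set.mem_image, Prod.mk.injEq, sub_eq_zero]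
    constructor
    · rintro ⟨ha, -, rfl⟩
      exact ⟨a, ha, rfl, rfl⟩
    · rintro ⟨x, hx, rfl, rfl⟩
      exact ⟨hx, hx, rfl⟩
  rw [diffCount, this, Set.ncard_image_of_injective]
  intro a b hab
  exact (Prod.mk.inj hab).1

/-! ### Character sums and partial difference sets -/

section Characters

variable {H : Type*} [AddCommGroup H] [Fintype H]

/-- The sum of the character `ψ` over the set `S`. -/
noncomputable def charSum (S : Set H) (ψ : AddChar H ℂ) : ℂ :=
  ∑ h, S.indicator 1 h * ψ h

/-- A function on a finite abelian group whose Fourier transform is supported at the trivial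
character is constant. -/
theorem eq_of_forall_sum_mul_char_eq_zero {f : H → ℂ}
    (hf : ∀ ψ : AddChar H ℂ, ψ ≠ 0 → ∑ h, f h * ψ h = 0) (a b : H) : f a = f b := by
  classical
  -- Fourier inversion at `a`: only the trivial character contributes.
  have key : ∀ a : H, (Fintype.card H : ℂ) * f a = ∑ h, f h := by
    intro a
    have h1 : ∑ ψ : AddChar H ℂ, ψ (-a) * ∑ h, f h * ψ h = ∑ h, f h := by
      rw [Finset.sum_eq_single (0 : AddChar H ℂ)]
      · simp
      · intro ψ _ hψ
        rw [hf ψ hψ, mul_zero]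
      · simp
    rw [← h1]
    simp_rw [Finset.mul_sum]
    rw [Finset.sum_comm]
    have h2 : ∀ h : H, ∑ ψ : AddChar H ℂ, ψ (-a) * (f h * ψ h)
        = if h = a then (Fintype.card H : ℂ) * f a else 0 := by
      intro h
      have h3 : ∑ ψ : AddChar H ℂ, ψ (-a) * (f h * ψ h)
          = f h * ∑ ψ : AddChar H ℂ, ψ (h - a) := by
        rw [Finset.mul_sum]
        refine Finset.sum_congr rfl fun ψ _ => ?_
        rw [sub_eq_add_neg, AddChar.map_add_eq_mul]
        ring
      rw [h3, AddChar.sum_apply_eq_ite]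
      by_cases hh : h = a
      · subst hh; simp [mul_comm]
      · simp [hh, sub_eq_zero]
    simp_rw [h2]
    simp
  have hc : (Fintype.card H : ℂ) ≠ 0 := by exact_mod_cast Fintype.card_ne_zero
  exact mul_left_cancel₀ hc ((key a).trans (key b).symm)

theorem sum_char_eq_zero {ψ : AddChar H ℂ} (hψ : ψ ≠ 0) : ∑ h, ψ h = 0 :=
  AddChar.sum_eq_zero_iff_ne_zero.2 hψ

theorem charSum_inv {S : Set H} (hS : ∀ x ∈ S, -x ∈ S) (ψ : AddChar H ℂ) :
    ∑ h, S.indicator 1 h * ψ (-h) = charSum S ψ := by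
  rw [charSum, ← Equiv.sum_comp (Equiv.neg H)]
  refine Finset.sum_congr rfl fun h _ => ?_
  have : -h ∈ S ↔ h ∈ S := ⟨fun hh => by simpa using hS _ hh, hS h⟩
  by_cases hh : h ∈ S <;> simp [hh, this]

open Classical in
theorem cast_diffCount (S : Set H) (x : H) :
    (diffCount S x : ℂ) = ∑ p : H × H,
      S.indicator 1 p.1 * S.indicator 1 p.2 * if p.1 - p.2 = x then 1 else 0 := by
  classical
  rw [diffCount, Set.ncard_eq_toFinset_card', Finset.card_eq_sum_ones, Nat.cast_sum]
  rw [← Finset.sum_subset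
    (Finset.subset_univ {p : H × H | p.1 ∈ S ∧ p.2 ∈ S ∧ p.1 - p.2 = x}.toFinset)]
  · refine Finset.sum_congr rfl fun p hp => ?_
    simp only [Set.mem_toFinset, Set.mem_ofPred_eq] at hp
    simp [hp.1, hp.2.1, hp.2.2]
  · intro p _ hp
    simp only [Set.mem_toFinset, Set.mem_ofPred_eq, not_and] at hp
    by_cases h1 : p.1 ∈ S
    · by_cases h2 : p.2 ∈ S
      · simp [hp h1 h2]
      · simp [h2]
    · simp [h1]

/-- `diffCount S` is the convolution of the indicators of `S` and `-S`, and symmetry makes both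
Fourier factors equal. -/
theorem sum_diffCount_mul_char {S : Set H} (hS : ∀ x ∈ S, -x ∈ S) (ψ : AddChar H ℂ) :
    ∑ x, (diffCount S x : ℂ) * ψ x = charSum S ψ ^ 2 := by
  classical
  have h1 : charSum S ψ ^ 2 =
      ∑ p : H × H, S.indicator 1 p.1 * S.indicator 1 p.2 * ψ (p.1 - p.2) := by
    rw [sq]
    nth_rewrite 2 [← charSum_inv hS]
    rw [charSum, Finset.sum_mul_sum, Fintype.sum_prod_type]
    refine Finset.sum_congr rfl fun a _ => Finset.sum_congr rfl fun b _ => ?_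
    rw [sub_eq_add_neg, AddChar.map_add_eq_mul]
    ring
  rw [h1]
  simp_rw [cast_diffCount, Finset.sum_mul]
  rw [Finset.sum_comm]
  refine Finset.sum_congr rfl fun p _ => ?_
  simp

/-- A set on which all nontrivial characters have the same sum is empty or everything,
up to the neutral element. -/
theorem eq_empty_or_eq_compl_of_charSum_eq {S : Set H} (h0 : 0 ∉ S) {a : ℂ}
    (ha : ∀ ψ : AddChar H ℂ, ψ ≠ 0 → charSum S ψ = a) : S = ∅ ∨ S = {0}ᶜ := by
  classical
  -- A point mass `a` at `0` has constant transform `a`; subtracting it leaves a constant function,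
  -- so the indicator of `S` is constant off `0`.
  have h1 := eq_of_forall_sum_mul_char_eq_zero
    (f := fun h => S.indicator 1 h - if h = 0 then a else 0) (by
      intro ψ hψ
      have := ha ψ hψ
      simp only [sub_mul, Finset.sum_sub_distrib]
      rw [← charSum, this]
      simp)
  by_contra! hS
  obtain ⟨⟨x, hx⟩, hS2⟩ := hS
  apply hS2
  ext y
  constructor
  · rintro hy rfl
    exact h0 hy
  · intro hy
    have hx0 : x ≠ 0 := fun h => h0 (h ▸ hx)
    have := h1 x y
    by_contra hyS
    simp [hx, hx0, hyS, show y ≠ 0 from hy] at this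

theorem charSum_empty (ψ : AddChar H ℂ) : charSum ∅ ψ = 0 := by
  simp [charSum]

theorem charSum_compl_zero {ψ : AddChar H ℂ} (hψ : ψ ≠ 0) : charSum ({0}ᶜ : Set H) ψ = -1 := by
  classical
  have : ∀ h : H, ({0}ᶜ : Set H).indicator 1 h * ψ h = ψ h - if h = 0 then 1 else 0 := by
    intro h
    by_cases hh : h = 0
    · simp [hh]
    · simp [hh]
  simp [charSum, this, sum_char_eq_zero hψ]

/-- The character sums of a partial difference set satisfy a quadratic equation. -/
theorem IsRegularPDS.charSum_sq {S : Set H} {N K l m : ℕ} (h : IsRegularPDS S N K l m)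
    {ψ : AddChar H ℂ} (hψ : ψ ≠ 0) :
    charSum S ψ ^ 2 = (K - m : ℂ) + (l - m : ℂ) * charSum S ψ := by
  classical
  obtain ⟨-, hK, h0, hS, hl, hm⟩ := h
  rw [← sum_diffCount_mul_char hS]
  -- The difference count is a combination of the constant `1`, the indicator of `S` and a point
  -- mass at `0`; a nontrivial `ψ` kills the constant.
  have h1 : ∀ x, (diffCount S x : ℂ) * ψ x = (m : ℂ) * ψ x
      + (l - m : ℂ) * (S.indicator 1 x * ψ x) + if x = 0 then (K - m : ℂ) else 0 := by
    intro x
    by_cases hx : x = 0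
    · subst hx
      simp [diffCount_zero, hK, h0]
    · by_cases hxS : x ∈ S
      · rw [show diffCount S x = l from hl x hxS]
        simp [hx, hxS]
        ring
      · rw [show diffCount S x = m from hm x hxS hx]
        simp [hx, hxS]
  simp_rw [h1, Finset.sum_add_distrib, ← Finset.mul_sum]
  rw [sum_char_eq_zero hψ, ← charSum]
  simp
  ring

/-- The quadratic equation says that `diffCount S`, corrected by multiples of the indicator of `S`
and of a point mass at `0`, has no nontrivial Fourier coefficient, so it is constant. -/
theorem isPDS_of_charSum_sq {S : Set H} (h0 : 0 ∉ S) (hS : ∀ x ∈ S, -x ∈ S) {c d : ℂ}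
    (h : ∀ ψ : AddChar H ℂ, ψ ≠ 0 → charSum S ψ ^ 2 = c + d * charSum S ψ) : IsPDS S := by
  classical
  have h1 := eq_of_forall_sum_mul_char_eq_zero
    (f := fun x => diffCount S x - d * S.indicator 1 x - if x = 0 then c else 0) (by
      intro ψ hψ
      simp only [sub_mul, Finset.sum_sub_distrib, mul_assoc]
      rw [sum_diffCount_mul_char hS, h ψ hψ, ← Finset.mul_sum, ← charSum]
      simp)
  have hl : ∃ l, ∀ x ∈ S, diffCount S x = l := by
    by_cases hne : ∃ y, y ∈ S
    · obtain ⟨y, hy⟩ := hne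
      refine ⟨diffCount S y, fun x hx => ?_⟩
      have := h1 x y
      simpa [hx, hy, ne_of_mem_of_not_mem hx h0, ne_of_mem_of_not_mem hy h0] using this
    · exact ⟨0, fun x hx => (hne ⟨x, hx⟩).elim⟩
  have hm : ∃ m, ∀ x ∉ S, x ≠ 0 → diffCount S x = m := by
    by_cases hne : ∃ y, y ∉ S ∧ y ≠ 0
    · obtain ⟨y, hy, hy0⟩ := hne
      refine ⟨diffCount S y, fun x hx hx0 => ?_⟩
      have := h1 x y
      simpa [hx, hy, hx0, hy0] using this
    · exact ⟨0, fun x hx hx0 => (hne ⟨x, hx, hx0⟩).elim⟩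
  obtain ⟨l, hl⟩ := hl
  obtain ⟨m, hm⟩ := hm
  exact ⟨_, _, l, m, rfl, rfl, h0, hS, hl, hm⟩

/-- A symmetric set is a nontrivial partial difference set if and only if its nontrivial character
sums take exactly two values. -/
theorem isPDS_and_iff_charSum_image {S : Set H} (h0 : 0 ∉ S) (hS : ∀ x ∈ S, -x ∈ S) :
    (IsPDS S ∧ S ≠ ∅ ∧ S ≠ {0}ᶜ) ↔
      ∃ a b, a ≠ b ∧ charSum S '' {ψ : AddChar H ℂ | ψ ≠ 0} = {a, b} := by
  constructor
  · rintro ⟨⟨N, K, l, m, h⟩, hne, hne'⟩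
    have hex : ∀ a : ℂ, ∃ ψ : AddChar H ℂ, ψ ≠ 0 ∧ charSum S ψ ≠ a := by
      intro a
      by_contra! ha
      exact (eq_empty_or_eq_compl_of_charSum_eq h0 ha).elim hne hne'
    -- The value `0` is arbitrary: only some nontrivial character is wanted.
    obtain ⟨ψ₁, hψ₁, -⟩ := hex 0
    obtain ⟨ψ₂, hψ₂, h12⟩ := hex (charSum S ψ₁)
    refine ⟨_, _, h12, Set.Subset.antisymm ?_ ?_⟩
    · rintro _ ⟨ψ, hψ, rfl⟩
      have e := h.charSum_sq (show ψ ≠ 0 from hψ)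
      have e₁ := h.charSum_sq hψ₁
      have e₂ := h.charSum_sq hψ₂
      by_contra hcon
      simp only [Set.mem_insert_iff, Set.mem_singleton_iff, not_or] at hcon
      -- Distinct roots of the quadratic sum to `l - m`, so a third value would force the first two
      -- to coincide.
      have f₁ : charSum S ψ + charSum S ψ₁ = (l - m : ℂ) :=
        mul_left_cancel₀ (sub_ne_zero.2 hcon.2) (by linear_combination e - e₁)
      have f₂ : charSum S ψ + charSum S ψ₂ = (l - m : ℂ) :=
        mul_left_cancel₀ (sub_ne_zero.2 hcon.1) (by linear_combination e - e₂)
      exact h12 (by linear_combination f₂ - f₁)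
    · rintro _ (rfl | rfl)
      · exact ⟨ψ₂, hψ₂, rfl⟩
      · exact ⟨ψ₁, hψ₁, rfl⟩
  · rintro ⟨a, b, hab, h⟩
    have hnc : ∀ c, ¬ ∀ ψ : AddChar H ℂ, ψ ≠ 0 → charSum S ψ = c := by
      intro c hc
      obtain ⟨ψ₁, hψ₁, e₁⟩ : a ∈ charSum S '' {ψ : AddChar H ℂ | ψ ≠ 0} := by simp [h]
      obtain ⟨ψ₂, hψ₂, e₂⟩ : b ∈ charSum S '' {ψ : AddChar H ℂ | ψ ≠ 0} := by simp [h]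
      exact hab (by rw [← e₁, ← e₂, hc _ hψ₁, hc _ hψ₂])
    -- Vieta coefficients of the quadratic with roots `a` and `b`.
    refine ⟨isPDS_of_charSum_sq h0 hS (c := -(a * b)) (d := a + b) ?_, ?_, ?_⟩
    · intro ψ hψ
      have : charSum S ψ ∈ ({a, b} : Set ℂ) := h ▸ ⟨ψ, hψ, rfl⟩
      rcases this with e | e <;> rw [e] <;> ring
    · rintro rfl
      exact hnc 0 fun ψ _ => charSum_empty ψ
    · rintro rfl
      exact hnc _ fun ψ hψ => charSum_compl_zero hψ

/-- Conjugation replaces `ψ h` by `ψ (-h)`. Real sums are what allow the two weights to be ordered.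
-/
theorem star_charSum {S : Set H} (hS : ∀ x ∈ S, -x ∈ S) (ψ : AddChar H ℂ) :
    star (charSum S ψ) = charSum S ψ := by
  classical
  nth_rewrite 2 [← charSum_inv hS]
  rw [charSum, star_sum]
  refine Finset.sum_congr rfl fun h _ => ?_
  rw [star_mul', AddChar.map_neg_eq_conj]
  by_cases hh : h ∈ S <;> simp [hh]

end Characters

/-! ### Generators of cyclic modules over finite rings -/

/-- Homomorphisms of finite groups with the same range have fibres of the same sizes. -/
theorem card_fiber_eq_of_range_eq {L M : Type*} [AddCommGroup L] [Finite L] [AddCommGroup M]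
    {φ ψ : L →+ M} (h : φ.range = ψ.range) (p : M) :
    Nat.card {t // φ t = p} = Nat.card {t // ψ t = p} := by
  have hfib : ∀ (φ : L →+ M) (t₀ : L), Nat.card {t // φ t = φ t₀} = Nat.card φ.ker := by
    intro φ t₀
    refine Nat.card_congr ((Equiv.subRight t₀).subtypeEquiv fun t => ?_)
    simp [AddMonoidHom.mem_ker, sub_eq_zero]
  by_cases hp : p ∈ φ.range
  · obtain ⟨t, rfl⟩ := hp
    obtain ⟨s, hs⟩ : φ t ∈ ψ.range := h ▸ ⟨t, rfl⟩
    rw [hfib, ← hs, hfib]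
    have h1 := φ.ker.card_mul_index
    have h2 := ψ.ker.card_mul_index
    rw [AddSubgroup.index_ker] at h1 h2
    rw [h] at h1
    have : Finite ψ.range := Set.finite_range ψ
    exact Nat.eq_of_mul_eq_mul_right Nat.card_pos (h1.trans h2.symm)
  · have e1 : IsEmpty {t // φ t = p} := ⟨fun t => hp ⟨t.1, t.2⟩⟩
    have e2 : IsEmpty {t // ψ t = p} := ⟨fun t => hp (h ▸ ⟨t.1, t.2⟩)⟩
    simp

/-- Two generators of a cyclic module over a finite ring differ by a unit. -/
theorem exists_unit_smul_eq_of_span_eq {A M : Type*} [Ring A] [Finite A] [AddCommGroup M]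
    [Module A M] {g h : M} (hgh : Submodule.span A {g} = Submodule.span A {h}) :
    ∃ u : Aˣ, u • g = h := by
  classical
  cases nonempty_fintype A
  obtain ⟨a, ha⟩ : ∃ a : A, a • g = h :=
    Submodule.mem_span_singleton.1 (hgh ▸ Submodule.mem_span_singleton_self h)
  obtain ⟨b, hb⟩ : ∃ b : A, b • h = g :=
    Submodule.mem_span_singleton.1 (hgh.symm ▸ Submodule.mem_span_singleton_self g)
  -- The `t` with `I t = 0` form a right ideal `L`, so `L g = L h` because `g` and `h` are multiples
  -- of each other. Equal ranges give equal fibre sizes.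
  have hA : ∀ (I : Ideal A) (p : M),
      (Finset.univ.filter fun t : A => I ≤ Ideal.torsionOf A A t ∧ t • g = p).card =
      (Finset.univ.filter fun t : A => I ≤ Ideal.torsionOf A A t ∧ t • h = p).card := by
    intro I p
    let L : AddSubgroup A :=
      { carrier := {t | I ≤ Ideal.torsionOf A A t}
        zero_mem' := fun i _ => by simp
        add_mem' := fun {s t} hs ht i hi => by
          have h1 := hs hi
          have h2 := ht hi
          simp only [Ideal.mem_torsionOf_iff, smul_eq_mul] at h1 h2 ⊢
          rw [mul_add, h1, h2, add_zero]
        neg_mem' := fun {s} hs i hi => by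
          have h1 := hs hi
          simp only [Ideal.mem_torsionOf_iff, smul_eq_mul] at h1 ⊢
          rw [mul_neg, h1, neg_zero] }
    let φ : M → L →+ M := fun m =>
      { toFun := fun t => (t : A) • m
        map_zero' := by simp
        map_add' := fun s t => by simp [add_smul] }
    have hle : ∀ (c : A) (m : M), (φ (c • m)).range ≤ (φ m).range := by
      rintro c m _ ⟨t, rfl⟩
      refine ⟨⟨t * c, fun i hi => ?_⟩, ?_⟩
      · have h1 := t.2 hi
        simp only [Ideal.mem_torsionOf_iff, smul_eq_mul] at h1 ⊢
        rw [← mul_assoc, h1, zero_mul]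
      · simp [φ, mul_smul]
    have hrange : (φ g).range = (φ h).range :=
      le_antisymm (by simpa only [hb] using hle b h) (by simpa only [ha] using hle a g)
    have hcard : ∀ m : M,
        (Finset.univ.filter fun t : A => I ≤ Ideal.torsionOf A A t ∧ t • m = p).card
        = Nat.card {t : L // φ m t = p} := by
      intro m
      rw [← Fintype.card_subtype, ← Nat.card_eq_fintype_card]
      exact Nat.card_congr (Equiv.subtypeSubtypeEquivSubtypeInter
        (fun t : A => I ≤ Ideal.torsionOf A A t) (fun t : A => t • m = p)).symm
    rw [hcard, hcard, card_fiber_eq_of_range_eq hrange]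
  -- From "annihilator contains `I`" to "annihilator equals `I`", by induction from larger ideals
  -- downwards, subtracting the strictly larger annihilators.
  have hE : ∀ (I : Ideal A) (p : M),
      (Finset.univ.filter fun t : A => Ideal.torsionOf A A t = I ∧ t • g = p).card =
      (Finset.univ.filter fun t : A => Ideal.torsionOf A A t = I ∧ t • h = p).card := by
    intro I
    induction I using WellFoundedGT.induction with
    | _ I ih =>
      intro p
      have hsplit : ∀ m : M,
          (Finset.univ.filter fun t : A => I ≤ Ideal.torsionOf A A t ∧ t • m = p).card =
          (Finset.univ.filter fun t : A => Ideal.torsionOf A A t = I ∧ t • m = p).card +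
          ∑ J ∈ Finset.univ.filter (fun J : Ideal A => I < J),
          (Finset.univ.filter fun t : A => Ideal.torsionOf A A t = J ∧ t • m = p).card := by
        intro m
        rw [Finset.card_eq_sum_card_fiberwise (f := fun t => Ideal.torsionOf A A t)
          (t := Finset.univ.filter fun J : Ideal A => I ≤ J) (by intro t; simp; tauto)]
        have : (Finset.univ.filter fun J : Ideal A => I ≤ J) =
            insert I (Finset.univ.filter fun J : Ideal A => I < J) := by
          ext J
          simp [le_iff_eq_or_lt, eq_comm]
        rw [this, Finset.sum_insert (by simp)]
        congr 1
        · congr 1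
          ext t
          simp only [Finset.mem_filter, Finset.mem_univ, true_and]
          constructor
          · rintro ⟨⟨-, h1⟩, h2⟩
            exact ⟨h2, h1⟩
          · rintro ⟨h1, h2⟩
            exact ⟨⟨h1.ge, h2⟩, h1⟩
        · refine Finset.sum_congr rfl fun J hJ => ?_
          congr 1
          ext t
          simp only [Finset.mem_filter, Finset.mem_univ, true_and] at hJ ⊢
          constructor
          · rintro ⟨⟨-, h1⟩, h2⟩
            exact ⟨h2, h1⟩
          · rintro ⟨h1, h2⟩
            exact ⟨⟨h1 ▸ hJ.le, h2⟩, h1⟩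
      have h1 := hA I p
      rw [hsplit, hsplit, Finset.sum_congr rfl fun J hJ => ih J (Finset.mem_filter.1 hJ).2 p] at h1
      exact Nat.add_right_cancel h1
  -- For `h` in place of `g` the count is positive thanks to `t = 1`. A `t` with zero left
  -- annihilator is a unit, as right multiplication by it is injective on a finite ring.
  have hpos : 0 < (Finset.univ.filter fun t : A => Ideal.torsionOf A A t = ⊥ ∧ t • g = h).card := by
    rw [hE]
    refine Finset.card_pos.2 ⟨1, ?_⟩
    simp [Submodule.eq_bot_iff, Ideal.mem_torsionOf_iff]
  obtain ⟨t, ht⟩ := Finset.card_pos.1 hpos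
  simp only [Finset.mem_filter, Finset.mem_univ, true_and] at ht
  have hinj : Function.Injective (· * t) := by
    intro x y hxy
    have : x - y ∈ Ideal.torsionOf A A t := by
      rw [Ideal.mem_torsionOf_iff, smul_eq_mul, sub_mul, sub_eq_zero]
      exact hxy
    rw [ht.1] at this
    exact sub_eq_zero.1 this
  obtain ⟨s, hs⟩ := Finite.surjective_of_injective hinj 1
  have hu : IsUnit t := by
    refine ⟨⟨t, s, hinj ?_, hs⟩, rfl⟩
    change t * s * t = 1 * t
    rw [mul_assoc, show s * t = 1 from hs, mul_one, one_mul]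
  obtain ⟨u, rfl⟩ := hu
  exact ⟨u, ht.2⟩

/-! ### Exchanging left and right multiplication under a generating character -/

section Nakayama

theorem IsGenerating.eq_of_forall_mul_right {R : Type*} [Ring R] {χ : AddChar R ℂ}
    (hχ : IsGenerating χ) {a b : R}
    (h : ∀ x, χ (x * a) = χ (x * b)) : a = b := by
  have hI := hχ (Ideal.span {a - b}) (by
    intro x hx
    obtain ⟨y, rfl⟩ := Ideal.mem_span_singleton'.1 hx
    rw [mul_sub, AddChar.map_sub_eq_div, h]
    exact div_self (AddChar.val_isUnit χ _).ne_zero)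
  exact sub_eq_zero.1 (Ideal.span_singleton_eq_bot.1 hI)

variable {R : Type*} [Ring R] [Finite R] {χ : AddChar R ℂ}

theorem IsGenerating.eq_of_forall_mul_left (hχ : IsGenerating χ) {a b : R}
    (h : ∀ x, χ (a * x) = χ (b * x)) : a = b := by
  have hI := (isGenerating_iff_right χ).1 hχ (Submodule.span Rᵐᵒᵖ {a - b}) (by
    intro x hx
    obtain ⟨y, rfl⟩ := Submodule.mem_span_singleton.1 hx
    rw [MulOpposite.smul_eq_mul_unop, sub_mul, AddChar.map_sub_eq_div, h]
    exact div_self (AddChar.val_isUnit χ _).ne_zero)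
  exact sub_eq_zero.1 (Submodule.span_singleton_eq_bot.1 hI)

/-- Left multiplications are turned into right multiplications under a generating character. -/
theorem IsGenerating.exists_mul_comm (hχ : IsGenerating χ) (r : R) :
    ∃ s, ∀ x, χ (r * x) = χ (x * s) := by
  cases nonempty_fintype R
  let φ : R → AddChar R ℂ := fun r => χ.compAddMonoidHom (AddMonoidHom.mulRight r)
  have hinj : Function.Injective φ := fun a b hab =>
    hχ.eq_of_forall_mul_right fun x => DFunLike.congr_fun hab x
  have hsurj : Function.Surjective φ :=
    -- `R` and its character group have the same size, so every character is `x ↦ χ (x * s)` for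
    -- some `s`.
    (Function.Injective.bijective_of_nat_card_le hinj (by simp [Nat.card_eq_fintype_card])).2
  obtain ⟨s, hs⟩ := hsurj (χ.compAddMonoidHom (AddMonoidHom.mulLeft r))
  exact ⟨s, fun x => (DFunLike.congr_fun hs x).symm⟩

/-- The partners of `u` and `u⁻¹` are mutually inverse, since multiplying by both does not change
`χ`. -/
theorem IsGenerating.exists_unit_mul_comm (hχ : IsGenerating χ) (u : Rˣ) :
    ∃ v : Rˣ, ∀ x, χ (u * x) = χ (x * v) := by
  obtain ⟨s, hs⟩ := hχ.exists_mul_comm (u : R)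
  obtain ⟨t, ht⟩ := hχ.exists_mul_comm ((u⁻¹ : Rˣ) : R)
  have h1 : s * t = 1 := hχ.eq_of_forall_mul_right fun x => by
    rw [← mul_assoc, ← ht, ← mul_assoc, ← hs]
    simp
  have h2 : t * s = 1 := hχ.eq_of_forall_mul_right fun x => by
    rw [← mul_assoc, ← hs, ← mul_assoc, ← ht]
    simp
  exact ⟨⟨s, t, h1, h2⟩, hs⟩

/-- The left and the right averages of a generating character over the units agree. -/
theorem IsGenerating.sum_unit_mul_comm [Fintype Rˣ] (hχ : IsGenerating χ) (x : R) :
    ∑ u : Rˣ, χ (u * x) = ∑ u : Rˣ, χ (x * u) := by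
  choose σ hσ using hχ.exists_unit_mul_comm
  have hinj : Function.Injective σ := fun u v huv =>
    Units.ext (hχ.eq_of_forall_mul_left fun x => by rw [hσ, hσ, huv])
  simp_rw [hσ]
  exact (Equiv.ofBijective σ (Finite.injective_iff_bijective.1 hinj)).sum_comp
    (fun u : Rˣ => χ (x * u))

end Nakayama

/-! ### Unit orbits and cyclic submodules -/

section Orbits

variable {R : Type*} [Ring R] {k : ℕ}

theorem mem_unitOrbit_self (g : Fin k → R) : g ∈ unitOrbit g :=
  ⟨1, by simp⟩

theorem mem_unitOrbit_comm {g h : Fin k → R} : g ∈ unitOrbit h ↔ h ∈ unitOrbit g := by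
  constructor <;>
  · rintro ⟨u, rfl⟩
    exact ⟨u⁻¹, by simp [mul_assoc]⟩

theorem unitOrbit_subset {g h : Fin k → R} (hg : g ∈ unitOrbit h) :
    unitOrbit g ⊆ unitOrbit h := by
  obtain ⟨u, rfl⟩ := hg
  rintro _ ⟨v, rfl⟩
  exact ⟨u * v, by simp [mul_assoc]⟩

theorem zero_notMem_unitOrbit {g : Fin k → R} (hg : g ≠ 0) : 0 ∉ unitOrbit g := by
  intro h
  obtain ⟨u, hu⟩ := mem_unitOrbit_comm.1 h
  exact hg (by rw [← hu]; ext i; simp)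

theorem unitOrbit_subset_cyclic (g : Fin k → R) : unitOrbit g ⊆ cyclic g := by
  rintro _ ⟨u, rfl⟩
  exact Submodule.mem_span_singleton.2 ⟨MulOpposite.op (u : R), rfl⟩

/-- Vectors over a finite ring generate the same cyclic submodule if and only if they differ by a
unit. -/
theorem cyclic_eq_iff [Finite R] {g h : Fin k → R} : cyclic g = cyclic h ↔ g ∈ unitOrbit h := by
  constructor
  · intro hgh
    have : Finite Rᵐᵒᵖ := Finite.of_equiv R MulOpposite.opEquiv
    obtain ⟨u, hu⟩ := exists_unit_smul_eq_of_span_eq (A := Rᵐᵒᵖ) hgh.symm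
    exact ⟨(Units.opEquiv u).unop, hu⟩
  · intro hg
    refine le_antisymm ?_ ?_
    · exact Submodule.span_le.2 (Set.singleton_subset_iff.2 (unitOrbit_subset_cyclic h hg))
    · exact Submodule.span_le.2 (Set.singleton_subset_iff.2
        (unitOrbit_subset_cyclic g (mem_unitOrbit_comm.1 hg)))

theorem unitOrbit_mulVec {l : ℕ} (A : Matrix (Fin l) (Fin k) R) (g : Fin k → R) :
    unitOrbit (A.mulVec g) = A.mulVec '' unitOrbit g := by
  rw [unitOrbit, unitOrbit, ← Set.range_comp]
  congr 1
  ext u i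
  simp [Matrix.mulVec, dotProduct, Finset.sum_mul, mul_assoc]

end Orbits

/-! ### Modularity and weights as sums over `Ω` -/

section Codes

variable {R : Type*} [Ring R] {k n : ℕ}

theorem mem_rowSpace_iff {G : Matrix (Fin k) (Fin n) R} {c : Fin n → R} :
    c ∈ rowSpace G ↔ ∃ x, Matrix.vecMul x G = c := by
  rw [rowSpace, ← range_vecMulLinear]
  rfl

/-- Matrices with the same row space are left multiples of each other; left multiplication commutes
with right units, so the orbit pattern of the columns depends only on the code. -/
theorem exists_mul_eq_of_rowSpace_le {l : ℕ} {G : Matrix (Fin k) (Fin n) R}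
    {G' : Matrix (Fin l) (Fin n) R} (h : rowSpace G' ≤ rowSpace G) :
    ∃ A : Matrix (Fin l) (Fin k) R, ∀ j, G'.col j = A.mulVec (G.col j) := by
  have h1 : ∀ i, ∃ x, Matrix.vecMul x G = G'.row i := fun i =>
    mem_rowSpace_iff.1 (h (Submodule.subset_span ⟨i, rfl⟩))
  choose A hA using h1
  refine ⟨A, fun j => ?_⟩
  ext i
  exact (congrFun (hA i) j).symm

/-- The multiplicity condition of a modular code, with respect to an arbitrary generator matrix
without zero columns. -/
theorem IsModular.exists_index [Finite R] {C : Submodule R (Fin n → R)} (hmod : IsModular C)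
    {G : Matrix (Fin k) (Fin n) R} (hG : rowSpace G = C) (hcol : ∀ j, G.col j ≠ 0) :
    ∃ r : ℚ, r ≠ 0 ∧ ∀ j, ({i | G.col i ∈ unitOrbit (G.col j)}.ncard : ℚ)
      = r * (unitOrbit (G.col j)).ncard := by
  obtain ⟨l, G', hG', r, hr⟩ := hmod
  obtain ⟨A, hA⟩ := exists_mul_eq_of_rowSpace_le (hG'.trans hG.symm).le
  obtain ⟨B, hB⟩ := exists_mul_eq_of_rowSpace_le (hG.trans hG'.symm).le
  have key : ∀ j, ({i | G.col i ∈ unitOrbit (G.col j)}.ncard : ℚ)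
      = r * (unitOrbit (G.col j)).ncard := by
    intro j
    have h0 : G'.col j ≠ 0 := by
      intro h
      exact hcol j (by rw [hB, h, Matrix.mulVec_zero])
    have h1 : {i | G.col i ∈ unitOrbit (G.col j)} =
        {i | cyclic (G'.col i) = cyclic (G'.col j)} := by
      ext i
      simp only [Set.mem_ofPred_eq, cyclic_eq_iff]
      constructor
      · intro h
        rw [hA, hA, unitOrbit_mulVec]
        exact ⟨_, h, rfl⟩
      · intro h
        rw [hB, hB, unitOrbit_mulVec]
        exact ⟨_, h, rfl⟩
    have h2 : (unitOrbit (G.col j)).ncard = (unitOrbit (G'.col j)).ncard := by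
      refine le_antisymm ?_ ?_
      · rw [hB, unitOrbit_mulVec]
        exact Set.ncard_image_le (Set.toFinite _)
      · rw [hA, unitOrbit_mulVec]
        exact Set.ncard_image_le (Set.toFinite _)
    -- Column `j` counts itself, which excludes multiplicity `0`.
    have h3 : pointMult G' (cyclic (G'.col j)) ≠ 0 := by
      exact Set.ncard_ne_zero_of_mem (a := j) rfl
    rw [h1, h2]
    exact (hr _ h0).resolve_left h3
  by_cases hn : Nonempty (Fin n)
  · obtain ⟨j⟩ := hn
    refine ⟨r, ?_, key⟩
    rintro rfl
    have := key j
    rw [zero_mul, Nat.cast_eq_zero, Set.ncard_eq_zero] at this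
    exact Set.eq_empty_iff_forall_notMem.1 this j (mem_unitOrbit_self _)
  · exact ⟨1, one_ne_zero, fun j => (hn ⟨j⟩).elim⟩

/-- Summing over all unit multiples of all columns amounts to summing over `Ω`. -/
theorem sum_units_col [Finite R] [Fintype Rˣ] [Fintype (Fin k → R)]
    {G : Matrix (Fin k) (Fin n) R} {r : ℚ}
    (hr : ∀ j, ({i | G.col i ∈ unitOrbit (G.col j)}.ncard : ℚ) = r * (unitOrbit (G.col j)).ncard)
    (F : (Fin k → R) → ℂ) :
    ∑ j, ∑ u : Rˣ, F (fun i => G.col j i * u)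
      = r * Nat.card Rˣ * ∑ y, (omega G).indicator 1 y * F y := by
  classical
  let m : Fin n × Rˣ → (Fin k → R) := fun p i => G.col p.1 i * p.2
  let N : (Fin k → R) → ℕ := fun y => (Finset.univ.filter fun p => m p = y).card
  have hN : ∀ g y, y ∈ unitOrbit g → N y = N g := by
    rintro g _ ⟨v, rfl⟩
    refine Finset.card_bij' (fun p _ => (p.1, p.2 * v⁻¹)) (fun p _ => (p.1, p.2 * v)) ?_ ?_ ?_ ?_
    · rintro ⟨i, u⟩ hp
      simp only [Finset.mem_filter, Finset.mem_univ, true_and, m] at hp ⊢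
      ext a
      have : G a i * u = g a * v := congrFun hp a
      simp [← mul_assoc, this]
    · rintro ⟨i, u⟩ hp
      simp only [Finset.mem_filter, Finset.mem_univ, true_and, m] at hp ⊢
      ext a
      have : G a i * u = g a := congrFun hp a
      simp [← mul_assoc, this]
    · simp
    · simp
  have hcol : ∀ j, (N (G.col j) : ℚ) = r * Nat.card Rˣ := by
    intro j
    -- Double counting of the pairs `(i, u)` landing in one orbit. As `N` is constant there, the
    -- orbit size cancels against the modularity condition.
    have h1 : ∑ y ∈ (unitOrbit (G.col j)).toFinset, N y =
        ({i | G.col i ∈ unitOrbit (G.col j)}.toFinset ×ˢ (Finset.univ : Finset Rˣ)).card := by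
      rw [Finset.card_eq_sum_card_fiberwise (f := m) (t := (unitOrbit (G.col j)).toFinset)]
      · refine Finset.sum_congr rfl fun y hy => ?_
        simp only [N]
        congr 1
        ext ⟨i, u⟩
        simp only [Finset.mem_filter, Finset.mem_univ, true_and, Finset.mem_product,
          Set.mem_toFinset, Set.mem_ofPred_eq, and_true] at hy ⊢
        refine ⟨fun h => ⟨?_, h⟩, fun h => h.2⟩
        subst h
        exact unitOrbit_subset hy (mem_unitOrbit_comm.1 ⟨u, rfl⟩)
      · rintro ⟨i, u⟩ h
        simp only [Finset.coe_product, Set.coe_toFinset, Finset.coe_univ, Set.mem_prod,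
          Set.mem_ofPred_eq, Set.mem_univ, and_true] at h ⊢
        exact unitOrbit_subset h ⟨u, rfl⟩
    rw [Finset.sum_congr rfl fun y hy => hN _ y (Set.mem_toFinset.1 hy), Finset.sum_const,
      Finset.card_product, ← Set.ncard_eq_toFinset_card', ← Set.ncard_eq_toFinset_card',
      Finset.card_univ, ← Nat.card_eq_fintype_card, smul_eq_mul] at h1
    have h2 : (unitOrbit (G.col j)).ncard ≠ 0 :=
      Set.ncard_ne_zero_of_mem (mem_unitOrbit_self _)
    have h3 : ((unitOrbit (G.col j)).ncard : ℚ) ≠ 0 := by exact_mod_cast h2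
    have h4 : ((unitOrbit (G.col j)).ncard : ℚ) * N (G.col j)
        = {i | G.col i ∈ unitOrbit (G.col j)}.ncard * Nat.card Rˣ := by exact_mod_cast h1
    rw [hr] at h4
    exact mul_left_cancel₀ h3 (by linear_combination h4)
  have hNω : ∀ y, (N y : ℂ) = r * Nat.card Rˣ * (omega G).indicator 1 y := by
    intro y
    by_cases hy : y ∈ omega G
    · obtain ⟨j, hj⟩ := Set.mem_iUnion.1 hy
      rw [hN _ _ hj, Set.indicator_of_mem hy]
      have := congrArg (fun q : ℚ => (q : ℂ)) (hcol j)
      simpa using this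
    · rw [Set.indicator_of_notMem hy, mul_zero, Nat.cast_eq_zero, Finset.card_eq_zero,
        Finset.filter_eq_empty_iff]
      rintro ⟨j, u⟩ - rfl
      exact hy (Set.mem_iUnion.2 ⟨j, u, rfl⟩)
  rw [← Fintype.sum_prod_type' (f := fun j (u : Rˣ) => F (fun i => G.col j i * u)),
    ← Finset.sum_fiberwise (g := m), Finset.mul_sum]
  refine Finset.sum_congr rfl fun y _ => ?_
  rw [← mul_assoc, ← hNω]
  rw [Finset.sum_congr rfl (g := fun _ => F y)]
  · rw [Finset.sum_const, nsmul_eq_mul]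
  · intro p hp
    rw [← (Finset.mem_filter.1 hp).2]

/-- The weights of a modular code are given by the character sums of `Ω`. -/
theorem wordWeight_vecMul [Finite R] [Fintype (Fin k → R)] {χ : AddChar R ℂ} (hχ : IsGenerating χ)
    {G : Matrix (Fin k) (Fin n) R} {r : ℚ}
    (hr : ∀ j, ({i | G.col i ∈ unitOrbit (G.col j)}.ncard : ℚ) = r * (unitOrbit (G.col j)).ncard)
    (x : Fin k → R) :
    wordWeight χ (Matrix.vecMul x G)
      = n - r * ∑ y, (omega G).indicator 1 y * χ (x ⬝ᵥ y) := by
  cases nonempty_fintype Rˣ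
  have hc : (Nat.card Rˣ : ℂ) ≠ 0 := by exact_mod_cast Nat.card_pos.ne'
  have h1 : ∀ j, homWeight χ (Matrix.vecMul x G j)
      = 1 - (Nat.card Rˣ : ℂ)⁻¹ * ∑ u : Rˣ, χ (x ⬝ᵥ fun i => G.col j i * u) := by
    intro j
    rw [homWeight, finsum_eq_sum_of_fintype, hχ.sum_unit_mul_comm]
    simp [Matrix.vecMul, dotProduct, Finset.sum_mul, mul_assoc]
  rw [wordWeight, Finset.sum_congr rfl fun j _ => h1 j, Finset.sum_sub_distrib, ← Finset.mul_sum,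
    sum_units_col hr (fun y => χ (x ⬝ᵥ y))]
  field_simp
  simp

end Codes

/-! ### Characters of the column space -/

section Duality

variable {R : Type*} [Ring R] {k n : ℕ} {χ : AddChar R ℂ}

/-- The character `y ↦ χ(x ⬝ᵥ y)` of a submodule of `R^k`. -/
def dotChar (χ : AddChar R ℂ) (D : Submodule Rᵐᵒᵖ (Fin k → R)) (x : Fin k → R) :
    AddChar D ℂ where
  toFun y := χ (x ⬝ᵥ (y : Fin k → R))
  map_zero_eq_one' := by simp
  map_add_eq_mul' a b := by simp [dotProduct_add, AddChar.map_add_eq_mul]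

theorem dotChar_apply (D : Submodule Rᵐᵒᵖ (Fin k → R)) (x : Fin k → R) (y : D) :
    dotChar χ D x y = χ (x ⬝ᵥ (y : Fin k → R)) := rfl

/-- All characters of a submodule of `R^k` are induced by vectors. -/
theorem IsGenerating.dotChar_surjective [Finite R] (hχ : IsGenerating χ)
    (D : Submodule Rᵐᵒᵖ (Fin k → R)) : Function.Surjective (dotChar χ D) := by
  classical
  cases nonempty_fintype R
  cases nonempty_fintype D
  intro ψ
  -- Otherwise `ψ` is orthogonal to every `dotChar χ D x`. Summing over `x` first leaves only `y =
  -- 0`, giving `|R^k| = 0`.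
  by_contra! hψ
  have h1 : ∀ x, ∑ y : D, ψ y * dotChar χ D (-x) y = 0 := by
    intro x
    have : ψ + dotChar χ D (-x) ≠ 0 := by
      intro h
      refine hψ x (DFunLike.ext _ _ fun y => ?_)
      have h2 : ψ y * dotChar χ D (-x) y = 1 := DFunLike.congr_fun h y
      have h3 : dotChar χ D x y * dotChar χ D (-x) y = 1 := by
        rw [dotChar_apply, dotChar_apply, ← AddChar.map_add_eq_mul, ← add_dotProduct]
        simp
      exact mul_right_cancel₀ (right_ne_zero_of_mul_eq_one h3) (h3.trans h2.symm)
    exact sum_char_eq_zero this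
  have h2 : ∀ y : D, ∑ x : Fin k → R, dotChar χ D (-x) y
      = if y = 0 then (Fintype.card (Fin k → R) : ℂ) else 0 := by
    intro y
    by_cases hy : y = 0
    · simp [hy]
    · rw [if_neg hy]
      let φ : AddChar (Fin k → R) ℂ :=
        { toFun := fun x => χ (x ⬝ᵥ (y : Fin k → R))
          map_zero_eq_one' := by simp
          map_add_eq_mul' := fun a b => by simp [add_dotProduct, AddChar.map_add_eq_mul] }
      have hφ : φ ≠ 0 := by
        intro h
        apply hy
        ext i
        refine hχ.eq_of_forall_mul_right fun a => ?_
        have : χ (Pi.single i a ⬝ᵥ (y : Fin k → R)) = 1 := DFunLike.congr_fun h (Pi.single i a)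
        simpa using this
      rw [← sum_char_eq_zero hφ, ← Equiv.sum_comp (Equiv.neg (Fin k → R))]
      simp [dotChar_apply, φ]
  have h3 : ∑ x : Fin k → R, ∑ y : D, ψ y * dotChar χ D (-x) y = 0 := by simp [h1]
  rw [Finset.sum_comm] at h3
  simp_rw [← Finset.mul_sum, h2] at h3
  simp at h3

/-- Testing on the right multiples `g_j a` recovers each coordinate of `xG`, since `χ` also
separates elements through right multiples. -/
theorem IsGenerating.dotChar_colSpace_eq_zero_iff [Finite R] (hχ : IsGenerating χ)
    {G : Matrix (Fin k) (Fin n) R} {x : Fin k → R} :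
    dotChar χ (colSpace G) x = 0 ↔ Matrix.vecMul x G = 0 := by
  constructor
  · intro h
    ext j
    refine hχ.eq_of_forall_mul_left fun a => ?_
    have hmem : (MulOpposite.op a • G.col j) ∈ colSpace G :=
      Submodule.smul_mem _ _ (Submodule.subset_span ⟨j, rfl⟩)
    have h1 : χ (x ⬝ᵥ (MulOpposite.op a • G.col j)) = 1 := DFunLike.congr_fun h ⟨_, hmem⟩
    rw [dotProduct_smul] at h1
    rw [Pi.zero_apply, zero_mul, AddChar.map_zero_eq_one]
    exact h1
  · intro h
    have h1 : ∀ y ∈ colSpace G, x ⬝ᵥ y = 0 := by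
      intro y hy
      induction hy using Submodule.span_induction with
      | mem y hy =>
        obtain ⟨j, rfl⟩ := hy
        exact congrFun h j
      | zero => simp
      | add a b _ _ ha hb => rw [dotProduct_add, ha, hb, add_zero]
      | smul a y _ hy => rw [dotProduct_smul, hy, smul_zero]
    ext y
    simp [dotChar_apply, h1 y y.2]

theorem omega_subset_colSpace (G : Matrix (Fin k) (Fin n) R) : omega G ⊆ colSpace G := by
  refine Set.iUnion_subset fun j => (unitOrbit_subset_cyclic _).trans ?_
  exact Submodule.span_mono (Set.singleton_subset_iff.2 ⟨j, rfl⟩)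

theorem neg_mem_omega {G : Matrix (Fin k) (Fin n) R} {y : Fin k → R} (hy : y ∈ omega G) :
    -y ∈ omega G := by
  obtain ⟨j, u, rfl⟩ := Set.mem_iUnion.1 hy
  exact Set.mem_iUnion.2 ⟨j, -u, by ext; simp⟩

theorem zero_notMem_omega {G : Matrix (Fin k) (Fin n) R} (hcol : ∀ j, G.col j ≠ 0) :
    0 ∉ omega G := by
  simp only [omega, Set.mem_iUnion, not_exists]
  exact fun j => zero_notMem_unitOrbit (hcol j)

theorem charSum_dotChar {D : Submodule Rᵐᵒᵖ (Fin k → R)} [Fintype D] [Fintype (Fin k → R)]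
    {Ω : Set (Fin k → R)} (hΩ : Ω ⊆ D) (x : Fin k → R) :
    charSum ((↑) ⁻¹' Ω : Set D) (dotChar χ D x) = ∑ y, Ω.indicator 1 y * χ (x ⬝ᵥ y) := by
  classical
  rw [charSum]
  refine Finset.sum_of_injOn (fun y : D => (y : Fin k → R)) Subtype.val_injective.injOn
    (by simp) ?_ ?_
  · intro y _ hy
    have : y ∉ Ω := fun h => hy ⟨⟨y, hΩ h⟩, by simp, rfl⟩
    simp [this]
  · intro y _
    simp [dotChar_apply, Set.indicator_apply]

/-- Such an `M` contains all columns, hence all of `D`. The empty case is that of a code of length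
`0`. -/
theorem exists_submodule_eq_omega_union_iff {G : Matrix (Fin k) (Fin n) R}
    (hcol : ∀ j, G.col j ≠ 0) :
    (∃ M : Submodule Rᵐᵒᵖ (Fin k → R), (M : Set (Fin k → R)) = omega G ∪ {0}) ↔
      ((↑) ⁻¹' omega G : Set (colSpace G)) = ∅ ∨ ((↑) ⁻¹' omega G : Set (colSpace G)) = {0}ᶜ := by
  have h0 := zero_notMem_omega hcol
  constructor
  · rintro ⟨M, hM⟩
    right
    have hle : colSpace G ≤ M := by
      refine Submodule.span_le.2 ?_
      rintro _ ⟨j, rfl⟩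
      rw [hM]
      exact Or.inl (Set.mem_iUnion.2 ⟨j, mem_unitOrbit_self _⟩)
    ext y
    have hy : (y : Fin k → R) ∈ omega G ∪ {0} := hM ▸ hle y.2
    constructor
    · rintro hyω rfl
      exact h0 hyω
    · intro hy0
      exact hy.resolve_right fun h => hy0 (Subtype.ext h)
  · rintro (h | h)
    · refine ⟨⊥, ?_⟩
      have : omega G = ∅ := by
        refine Set.eq_empty_iff_forall_notMem.2 fun y hy => ?_
        exact Set.eq_empty_iff_forall_notMem.1 h ⟨y, omega_subset_colSpace G hy⟩ hy
      simp [this]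
    · refine ⟨colSpace G, ?_⟩
      ext y
      constructor
      · intro hy
        by_cases hy0 : y = 0
        · exact Or.inr hy0
        · have : (⟨y, hy⟩ : colSpace G) ∈ ((↑) ⁻¹' omega G : Set (colSpace G)) := by
            rw [h]
            exact fun h' => hy0 (congrArg Subtype.val h')
          exact Or.inl this
      · rintro (hy | rfl)
        · exact omega_subset_colSpace G hy
        · exact Submodule.zero_mem _

end Duality

/-! ### From character sums to weights -/

/-- Having exactly two values is preserved by nonconstant affine maps, and for real values the two
values can be ordered. -/
theorem exists_real_pair_iff {V : Set ℂ} (hV : ∀ z ∈ V, star z = z) (n : ℕ) {r : ℚ} (hr : r ≠ 0) :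
    (∃ w₁ w₂ : ℝ, w₁ < w₂ ∧ (fun z : ℂ => n - r * z) '' V = {(w₁ : ℂ), (w₂ : ℂ)}) ↔
      ∃ a b, a ≠ b ∧ V = {a, b} := by
  have hr' : (r : ℂ) ≠ 0 := by exact_mod_cast hr
  have hinj : Function.Injective fun z : ℂ => n - r * z := fun a b hab =>
    mul_left_cancel₀ hr' (sub_right_injective hab)
  constructor
  · rintro ⟨w₁, w₂, hw, h⟩
    have hinv : ∀ w : ℂ, (n : ℂ) - r * ((n - w) / r) = w := fun w => by field_simp; ring
    refine ⟨(n - w₁) / r, (n - w₂) / r, fun h12 => hw.ne ?_, ?_⟩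
    · have := congrArg (fun z : ℂ => n - r * z) h12
      simp only [hinv] at this
      exact_mod_cast this
    · apply hinj.image_injective
      simp only [Set.image_pair, hinv]
      exact h
  · rintro ⟨a, b, hab, rfl⟩
    obtain ⟨s, rfl⟩ := Complex.conj_eq_iff_real.1 (hV a (by simp))
    obtain ⟨t, rfl⟩ := Complex.conj_eq_iff_real.1 (hV b (by simp))
    have hst : (n - r * s : ℝ) ≠ n - r * t := fun h =>
      hab (hinj (by simpa using congrArg (fun x : ℝ => (x : ℂ)) h))
    rcases hst.lt_or_gt with h | h
    · exact ⟨_, _, h, by simp [Set.image_pair]⟩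
    · exact ⟨_, _, h, by simp [Set.image_pair, Set.pair_comm]⟩

end FrobCode

theorem mainTheorem4 {R : Type*} [Ring R] [Finite R]
    (χ : AddChar R ℂ) (hχ : FrobCode.IsGenerating χ)
    {k n : ℕ} (C : Submodule R (Fin n → R)) (G : Matrix (Fin k) (Fin n) R)
    (hG : FrobCode.rowSpace G = C)
    (hmod : FrobCode.IsModular C)
    (hcoord : ∀ j : Fin n, ∃ c ∈ C, c j ≠ 0)
    (hC₀ : {c : Fin n → R | c ∈ C ∧ FrobCode.wordWeight χ c = 0} = {0}) :
    FrobCode.IsTwoWeight χ C ↔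
      (FrobCode.IsPDS
          ((↑) ⁻¹' FrobCode.omega G : Set (FrobCode.colSpace G)) ∧
        ¬ ∃ M : Submodule Rᵐᵒᵖ (Fin k → R),
            (M : Set (Fin k → R)) = FrobCode.omega G ∪ {0}) := by
  open FrobCode in
  cases nonempty_fintype (Fin k → R)
  cases nonempty_fintype (colSpace G)
  have hcol : ∀ j, G.col j ≠ 0 := by
    intro j hj
    obtain ⟨c, hc, hcj⟩ := hcoord j
    obtain ⟨x, rfl⟩ := mem_rowSpace_iff.1 (hG ▸ hc)
    exact hcj ((congrArg (x ⬝ᵥ ·) hj).trans (dotProduct_zero x))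
  obtain ⟨r, hr0, hr⟩ := hmod.exists_index hG hcol
  set S : Set (colSpace G) := (↑) ⁻¹' omega G
  have hS0 : 0 ∉ S := zero_notMem_omega hcol
  have hSneg : ∀ y ∈ S, -y ∈ S := fun y hy => neg_mem_omega hy
  have hweight : ∀ x, wordWeight χ (Matrix.vecMul x G)
      = n - r * charSum S (dotChar χ (colSpace G) x) := by
    intro x
    rw [wordWeight_vecMul hχ hr, charSum_dotChar (omega_subset_colSpace G)]
  have himage : wordWeight χ '' (C : Set (Fin n → R)) \ {0} =
      (fun z : ℂ => n - r * z) '' (charSum S '' {ψ : AddChar (colSpace G) ℂ | ψ ≠ 0}) := by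
    -- By `hC₀`, removing the weight `0` removes just the zero word, which corresponds to the
    -- trivial character.
    have hzero : ∀ c ∈ C, (wordWeight χ c = 0 ↔ c = 0) := fun c hc =>
      ⟨fun h => (hC₀ ▸ ⟨hc, h⟩ : c ∈ ({0} : Set (Fin n → R))), fun h =>
        ((hC₀.symm ▸ h : c ∈ {c : Fin n → R | c ∈ C ∧ wordWeight χ c = 0})).2⟩
    ext w
    constructor
    · rintro ⟨⟨c, hc, rfl⟩, hw⟩
      obtain ⟨x, rfl⟩ := mem_rowSpace_iff.1 (hG ▸ hc)
      refine ⟨_, ⟨dotChar χ (colSpace G) x, ?_, rfl⟩, (hweight x).symm⟩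
      exact fun h => hw ((hzero _ hc).2 (hχ.dotChar_colSpace_eq_zero_iff.1 h))
    · rintro ⟨_, ⟨ψ, hψ, rfl⟩, rfl⟩
      obtain ⟨x, rfl⟩ := hχ.dotChar_surjective _ ψ
      have hc : Matrix.vecMul x G ∈ C := hG ▸ mem_rowSpace_iff.2 ⟨x, rfl⟩
      refine ⟨⟨_, hc, hweight x⟩, fun h => hψ ?_⟩
      exact hχ.dotChar_colSpace_eq_zero_iff.2 ((hzero _ hc).1 ((hweight x).trans h))
  rw [exists_submodule_eq_omega_union_iff hcol, not_or, isPDS_and_iff_charSum_image hS0 hSneg,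
    IsTwoWeight, himage, exists_real_pair_iff _ n hr0]
  rintro _ ⟨ψ, -, rfl⟩
  exact star_charSum hSneg ψ
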